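/- Let $k$ be a field, let $l\ge 1$ and $n\ge 2$ be integers, and let $Q$ be a finite quiver which is a basic oriented cycle of length $l$, i.e. $Q$ has exactly $l$ pairwise distinct vertices $s_i$ and exactly $l$ arrows $a_i\colon s_i\to s_{i+1}$, with $i\in\mathbb Z/l$ (for $l=1$, one vertex with one loop). Let $A=kQ/k^nQ$, where $kQ$ is the path algebra of $Q$ and $k^nQ$ is the two-sided ideal of $kQ$ generated by all paths of length $\ge n$. For $i\ge 0$ let $hh_i(A)=\dim_k HH_i(A)$, where $HH_i(A)$ is the $i$-th homology of the Hochschild complex $(A^{\otimes_k (m+1)},b_m)_{m\ge 0}$, with $$b_m(a_0\otimes\cdots\otimes a_m)=\sum_{j=0}^{m-1}(-1)^j a_0\otimes\cdots\otimes a_ja_{j+1}\otimes\cdots\otimes a_m+(-1)^m a_ma_0\otimes a_1\otimes\cdots\otimes a_{m-1}$$ for $m\ge1$ and $b_0=0$, and let $\mathrm{hh.dim.}\,A=\inf\{m\in\mathbb N_0 : hh_i(A)=0\text{ for all } i>m\}$ (with $\inf\emptyset=\infty$). Then $$\mathrm{hh.dim.}\,A=\infty .$$ -/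

import Mathlib

open scoped TensorProduct

universe u v w

noncomputable section

/-! ### Path algebras and truncated quiver algebras -/

/-- The type of all paths of a quiver, including the trivial path at every vertex. -/
abbrev QuiverPath (V : Type u) [Quiver.{v} V] : Type (max u v) :=
  Σ x : V, Σ y : V, Quiver.Path x y

/-- The path algebra `kQ`: the vector space with basis the paths of the quiver. The product of two
paths is their concatenation (first the left factor, then the right one) if the end of the first
is the start of the second, and `0` otherwise. -/
def PathAlgebra (k : Type w) [Field k] (V : Type u) [Quiver.{v} V] : Type (max u v w) :=
  QuiverPath V →₀ k

namespace PathAlgebra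

variable (k : Type w) [Field k] (V : Type u) [Quiver.{v} V]

instance : AddCommGroup (PathAlgebra k V) := inferInstanceAs (AddCommGroup (QuiverPath V →₀ k))

instance : Module k (PathAlgebra k V) := inferInstanceAs (Module k (QuiverPath V →₀ k))

variable {V}

/-- The basis vector of the path algebra given by a path. -/
def single (p : QuiverPath V) : PathAlgebra k V := Finsupp.single p (1 : k)

open Classical in
/-- The product of two basis vectors. -/
def pathMul (p q : QuiverPath V) : PathAlgebra k V :=
  if h : p.2.1 = q.1 then
    single k ⟨p.1, q.2.1, p.2.2.comp (q.2.2.cast h.symm rfl)⟩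
  else 0

variable (V)

/-- The multiplication of the path algebra as a bilinear map. -/
def mulLin : PathAlgebra k V →ₗ[k] PathAlgebra k V →ₗ[k] PathAlgebra k V :=
  Finsupp.lift (PathAlgebra k V →ₗ[k] PathAlgebra k V) k (QuiverPath V) fun p =>
    Finsupp.lift (PathAlgebra k V) k (QuiverPath V) fun q => pathMul k p q

instance : Mul (PathAlgebra k V) := ⟨fun a b => mulLin k V a b⟩

instance [Fintype V] : One (PathAlgebra k V) :=
  ⟨∑ x : V, single k ⟨x, x, Quiver.Path.nil⟩⟩

variable {k V}

theorem mul_def (a b : PathAlgebra k V) : a * b = mulLin k V a b := rfl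

theorem lift_single {M : Type*} [AddCommGroup M] [Module k M] (f : QuiverPath V → M)
    (p : QuiverPath V) : Finsupp.lift M k (QuiverPath V) f (Finsupp.single p 1) = f p := by
  simp

theorem single_mul_single (p q : QuiverPath V) : single k p * single k q = pathMul k p q :=
  (LinearMap.congr_fun (lift_single _ p) (single k q)).trans (lift_single _ q)

theorem lin_ext {M : Type*} [AddCommGroup M] [Module k M] {f g : PathAlgebra k V →ₗ[k] M}
    (h : ∀ p, f (single k p) = g (single k p)) : f = g :=
  Finsupp.lhom_ext' fun p => LinearMap.ext_ring (h p)

theorem pathMul_assoc (p q r : QuiverPath V) :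
    pathMul k p q * single k r = single k p * pathMul k q r := by
  have hz : ∀ a : PathAlgebra k V, a * 0 = 0 := fun a => map_zero (mulLin k V a)
  have zh : ∀ a : PathAlgebra k V, 0 * a = 0 := fun a => LinearMap.map_zero₂ (mulLin k V) a
  obtain ⟨x, y, p⟩ := p
  obtain ⟨y', z, q⟩ := q
  obtain ⟨z', t, r⟩ := r
  by_cases h₁ : y = y' <;> by_cases h₂ : z = z'
  · subst h₁ h₂
    simp [pathMul, single_mul_single, Quiver.Path.comp_assoc]
  · subst h₁
    simp [pathMul, single_mul_single, h₂, hz]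
  · subst h₂
    simp [pathMul, single_mul_single, h₁, zh]
  · simp [pathMul, h₁, h₂, hz, zh]

theorem mul_assoc' (a b c : PathAlgebra k V) : a * b * c = a * (b * c) := by
  have h₁ : ∀ p q : QuiverPath V, mulLin k V (single k p * single k q)
      = mulLin k V (single k p) ∘ₗ mulLin k V (single k q) := fun p q =>
    lin_ext fun r => by
      have := pathMul_assoc (k := k) p q r
      rw [← single_mul_single, ← single_mul_single] at this
      exact this
  have h₂ : ∀ (p : QuiverPath V) (c : PathAlgebra k V),
      (mulLin k V).flip c ∘ₗ mulLin k V (single k p)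
        = mulLin k V (single k p) ∘ₗ (mulLin k V).flip c := fun p c =>
    lin_ext fun q => LinearMap.congr_fun (h₁ p q) c
  have h₃ : (mulLin k V).flip c ∘ₗ (mulLin k V).flip b = (mulLin k V).flip (b * c) :=
    lin_ext fun p => LinearMap.congr_fun (h₂ p c) b
  exact LinearMap.congr_fun h₃ a

theorem one_mul' [Fintype V] (a : PathAlgebra k V) : 1 * a = a := by
  classical
  have h : mulLin k V 1 = LinearMap.id := by
    refine lin_ext fun p => ?_
    obtain ⟨x, y, p⟩ := p
    change mulLin k V (∑ z : V, single k ⟨z, z, Quiver.Path.nil⟩) _ = _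
    rw [map_sum, LinearMap.sum_apply]
    refine (Finset.sum_congr rfl fun z _ => single_mul_single _ _).trans ?_
    rw [Finset.sum_eq_single x]
    · simp [pathMul]
    · intro z _ hz
      simp [pathMul, hz]
    · simp
  exact LinearMap.congr_fun h a

theorem mul_one' [Fintype V] (a : PathAlgebra k V) : a * 1 = a := by
  classical
  have h : (mulLin k V).flip 1 = LinearMap.id := by
    refine lin_ext fun p => ?_
    obtain ⟨x, y, p⟩ := p
    refine (map_sum (mulLin k V (single k ⟨x, y, p⟩))
      (fun z : V => single k ⟨z, z, Quiver.Path.nil⟩) Finset.univ).trans ?_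
    refine (Finset.sum_congr rfl fun z _ => single_mul_single _ _).trans ?_
    rw [Finset.sum_eq_single y]
    · simp [pathMul]
    · intro z _ hz
      simp [pathMul, Ne.symm hz]
    · simp
  exact LinearMap.congr_fun h a

instance [Fintype V] : Ring (PathAlgebra k V) where
  __ := (inferInstance : AddCommGroup (PathAlgebra k V))
  mul_assoc := mul_assoc'
  one_mul := one_mul'
  mul_one := mul_one'
  left_distrib a b c := map_add (mulLin k V a) b c
  right_distrib a b c := LinearMap.map_add₂ (mulLin k V) a b c
  zero_mul a := LinearMap.map_zero₂ (mulLin k V) a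
  mul_zero a := map_zero (mulLin k V a)

instance [Fintype V] : Algebra k (PathAlgebra k V) :=
  Algebra.ofModule (fun c a b => LinearMap.map_smul₂ (mulLin k V) c a b)
    (fun c a b => map_smul (mulLin k V a) c b)

end PathAlgebra

/-- The two-sided ideal `kⁿQ` of the path algebra generated by all paths of length at least `n`. -/
def truncationIdeal (k : Type w) [Field k] (V : Type u) [Quiver.{v} V] [Fintype V] (n : ℕ) :
    TwoSidedIdeal (PathAlgebra k V) :=
  TwoSidedIdeal.span {a | ∃ p : QuiverPath V, n ≤ p.2.2.length ∧ a = PathAlgebra.single k p}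

/-- The truncated quiver algebra `kQ/kⁿQ`. -/
abbrev TruncatedQuiverAlgebra (k : Type w) [Field k] (V : Type u) [Quiver.{v} V] [Fintype V]
    (n : ℕ) : Type (max u v w) :=
  (truncationIdeal k V n).ringCon.Quotient

/-- The quiver is a basic cycle of length `l ≥ 1`: its vertices are pairwise distinct
`s i`, `i ∈ ℤ/l`, and its arrows are exactly one arrow `a i` from `s i` to `s (i + 1)` for every
`i ∈ ℤ/l`. For `l = 1` this is one vertex with one loop. -/
def IsBasicCycle (V : Type u) [Quiver.{v} V] (l : ℕ) : Prop :=
  1 ≤ l ∧ ∃ (s : ZMod l → V) (a : ∀ i : ZMod l, s i ⟶ s (i + 1)),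
    Function.Bijective s ∧
    Function.Bijective (fun i : ZMod l => (⟨s i, s (i + 1), a i⟩ : Quiver.Total V))

/-! ### Hochschild homology -/

section Hochschild

variable (k : Type w) [Field k] (A : Type u) [Ring A] [Algebra k A]

variable {A} in
/-- The `i`-th face of the tuple `(a₀, …, a_{n+1})`: for `i ≤ n` it is
`(a₀, …, aᵢ aᵢ₊₁, …, a_{n+1})`, and for `i = n + 1` it is `(a_{n+1} a₀, a₁, …, aₙ)`. -/
def hochschildFace (n : ℕ) (i : Fin (n + 2)) (a : Fin (n + 2) → A) : Fin (n + 1) → A := fun j =>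
  if i = Fin.last (n + 1) then
    if j = 0 then a (Fin.last (n + 1)) * a 0 else a j.castSucc
  else
    if j.castSucc < i then a j.castSucc
    else if j.castSucc = i then a j.castSucc * a j.succ
    else a j.succ

theorem hochschildFace_update (n : ℕ) [DecidableEq (Fin (n + 2))] (i : Fin (n + 2))
    (a : Fin (n + 2) → A) (m : Fin (n + 2)) :
    ∃ (j : Fin (n + 1)) (L : A →ₗ[k] A), ∀ x : A,
      hochschildFace n i (Function.update a m x) =
        Function.update (hochschildFace n i a) j (L x) := by
  by_cases hi : i = Fin.last (n + 1)
  · by_cases h0 : m = 0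
    · refine ⟨0, LinearMap.mulLeft k (a (Fin.last (n + 1))), fun x => funext fun j => ?_⟩
      simp only [hochschildFace, Function.update_apply, LinearMap.mulLeft_apply]
      grind
    by_cases hl : m = Fin.last (n + 1)
    · refine ⟨0, LinearMap.mulRight k (a 0), fun x => funext fun j => ?_⟩
      simp only [hochschildFace, Function.update_apply, LinearMap.mulRight_apply]
      grind
    · refine ⟨⟨m, by grind⟩, LinearMap.id, fun x => funext fun j => ?_⟩
      simp only [hochschildFace, Function.update_apply, LinearMap.id_apply]
      grind
  · by_cases h0 : m = i
    · refine ⟨⟨m, by grind⟩, LinearMap.mulRight k (a ⟨i + 1, by grind⟩),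
        fun x => funext fun j => ?_⟩
      simp only [hochschildFace, Function.update_apply, LinearMap.mulRight_apply]
      grind
    by_cases hl : (m : ℕ) = i + 1
    · refine ⟨⟨i, by grind⟩, LinearMap.mulLeft k (a i), fun x => funext fun j => ?_⟩
      simp only [hochschildFace, Function.update_apply, LinearMap.mulLeft_apply]
      grind
    by_cases hlt : m < i
    · refine ⟨⟨m, by grind⟩, LinearMap.id, fun x => funext fun j => ?_⟩
      simp only [hochschildFace, Function.update_apply, LinearMap.id_apply]
      grind
    · refine ⟨⟨m - 1, by grind⟩, LinearMap.id, fun x => funext fun j => ?_⟩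
      simp only [hochschildFace, Function.update_apply, LinearMap.id_apply]
      grind

/-- The `i`-th face as a linear map `A^{⊗ n+2} → A^{⊗ n+1}`. -/
def hochschildFaceLin (n : ℕ) (i : Fin (n + 2)) :
    (⨂[k] _ : Fin (n + 2), A) →ₗ[k] (⨂[k] _ : Fin (n + 1), A) :=
  PiTensorProduct.lift
    { toFun := fun a => PiTensorProduct.tprod k (hochschildFace n i a)
      map_update_add' := by
        intro _ a m x y
        obtain ⟨j, L, h⟩ := hochschildFace_update k A n i a m
        simp only [h, map_add, MultilinearMap.map_update_add]
      map_update_smul' := by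
        intro _ a m c x
        obtain ⟨j, L, h⟩ := hochschildFace_update k A n i a m
        simp only [h, map_smul, MultilinearMap.map_update_smul] }

/-- The Hochschild boundary `b_{n+1} : A^{⊗ n+2} → A^{⊗ n+1}`. -/
def hochschildB (n : ℕ) : (⨂[k] _ : Fin (n + 2), A) →ₗ[k] (⨂[k] _ : Fin (n + 1), A) :=
  ∑ i : Fin (n + 2), (-1 : k) ^ (i : ℕ) • hochschildFaceLin k A n i

variable {A} in
theorem hochschildFace_hochschildFace (n : ℕ) (i : Fin (n + 2)) (j : Fin (n + 3))
    (h : (j : ℕ) ≤ i) (a : Fin (n + 3) → A) :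
    hochschildFace n i (hochschildFace (n + 1) j a) =
      hochschildFace n ⟨j, h.trans_lt i.2⟩ (hochschildFace (n + 1) i.succ a) := by
  funext m
  simp only [hochschildFace]
  grind (splits := 30)

/-- The Hochschild complex is a complex. -/
theorem hochschildB_comp (n : ℕ) : hochschildB k A n ∘ₗ hochschildB k A (n + 1) = 0 := by
  have hf : ∀ (i : Fin (n + 2)) (j : Fin (n + 3)) (h : (j : ℕ) ≤ i),
      hochschildFaceLin k A n i ∘ₗ hochschildFaceLin k A (n + 1) j =
      hochschildFaceLin k A n ⟨j, h.trans_lt i.2⟩ ∘ₗ hochschildFaceLin k A (n + 1) i.succ := by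
    intro i j h
    ext a
    simp [hochschildFaceLin, hochschildFace_hochschildFace n i j h a]
  ext a
  simp only [hochschildB, LinearMap.compMultilinearMap_apply, LinearMap.comp_apply,
    LinearMap.sum_apply, map_sum, LinearMap.smul_apply, map_smul, Finset.smul_sum,
    smul_smul, ← pow_add]
  rw [Finset.sum_comm, ← Finset.sum_product', Finset.univ_product_univ, LinearMap.zero_apply]
  rw [← Finset.sum_filter_add_sum_filter_not _
    (fun ij : Fin (n + 2) × Fin (n + 3) => (ij.2 : ℕ) ≤ ij.1), ← eq_neg_iff_add_eq_zero,
    ← Finset.sum_neg_distrib]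
  refine Finset.sum_bij (fun ij hij => (⟨ij.2, by grind⟩, ij.1.succ)) ?_ ?_ ?_ ?_
  · grind
  · grind
  · rintro ⟨i, j⟩ hij
    refine ⟨(⟨j - 1, by grind⟩, i.castSucc), by grind, by grind⟩
  · rintro ⟨i, j⟩ hij
    have := LinearMap.congr_fun (hf i j (by grind)) (PiTensorProduct.tprod k a)
    simp only [LinearMap.comp_apply] at this
    rw [this]
    simp only [Fin.val_succ, ← neg_smul]
    congr 1
    ring

/-- The Hochschild `n`-cycles: the kernel of `b_n`, where `b₀` is the map `A → 0`. -/
def hochschildCycles : (n : ℕ) → Submodule k (⨂[k] _ : Fin (n + 1), A)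
  | 0 => ⊤
  | n + 1 => LinearMap.ker (hochschildB k A n)

/-- The `n`-th Hochschild homology group `HH_n(A) = ker b_n / im b_{n+1}`. -/
abbrev HochschildHomology (n : ℕ) : Type (max u w) :=
  hochschildCycles k A n ⧸
    (LinearMap.range (hochschildB k A n)).submoduleOf (hochschildCycles k A n)

/-- `hh_n(A)`, the dimension over `k` of the `n`-th Hochschild homology group. -/
def hochschildHomologyRank (n : ℕ) : Cardinal := Module.rank k (HochschildHomology k A n)

/-- The Hochschild homology dimension `inf {n | hh_i(A) = 0 for all i > n}`; the infimum of the
empty set is `∞`. -/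
def hochschildHomologyDim : ℕ∞ :=
  ⨅ (n : ℕ) (_ : ∀ i : ℕ, n < i → hochschildHomologyRank k A i = 0), (n : ℕ∞)

end Hochschild

end

/-! ### Cochains on composable tuples -/

/-! The algebra `A` has a basis of paths `E x a`, with start `x` in ℤ/l and length `a < n`. A face
of a tensor of such paths is again one or is 0, and nonzero faces preserve both the total length and
the property of composing to a closed path. In infinitely many degrees an explicit cycle is paired
with an explicit cocycle to a nonzero value; no step depends on the characteristic.

The cycle is a pure tensor of paths whose cyclically adjacent lengths add up to at least `n`, so
each of its faces vanishes separately. Its entries close up exactly when `l` divides the total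
length. The cocycle tests, on closed tuples of the given total length, whether disjoint pairs of
neighbours have length sum at least `n`. Its coboundary telescopes by `sum_pairInd_mergeAt`, and the
bound on total length handles the faces that touch entry 0.

If `n` and `l` are coprime, lengths `n-1, n-1, 1, n-1, 1, …` give even-degree classes of total
length `-1` mod `n`, and infinitely many such totals are divisible by `l` (`evenCochain_closed`). If
`d = gcd(n, l) > 1`, lengths `n-1, 1, n-1, 1, …` give odd-degree classes of total length a multiple
of `n`. There the cocycle carries the weight `g(start) - g(end)` of entry 1, for an `n`-periodic `g`
on ℤ/l; a nonconstant `g` exists because `d > 1` (`oddCochain_closed`). -/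

namespace CycleCochain

/-- Merge the entries `i` and `i + 1` of a sequence of lengths. -/
def mergeAt (i : ℕ) (a : ℕ → ℕ) : ℕ → ℕ := fun j =>
  if j < i then a j else if j = i then a i + a (i + 1) else a (j + 1)

/-- Delete the entry `i + 1` of a sequence. -/
def dropAt {X : Type*} (i : ℕ) (v : ℕ → X) : ℕ → X := fun j => if j ≤ i then v j else v (j + 1)

/-- Replace the entry `0` of a sequence. -/
def setZero {X : Type*} (x : X) (v : ℕ → X) : ℕ → X := fun j => if j = 0 then x else v j

/-- The paths starting at `v 0, …, v m` of lengths `a 0, …, a m` compose to a closed path. -/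
def Composable {l : ℕ} (m : ℕ) (v : ℕ → ZMod l) (a : ℕ → ℕ) : Prop :=
  (∀ j < m, v (j + 1) = v j + a j) ∧ v 0 = v m + a m

/-- Merging loses only the junction between entries `i` and `i + 1`, which `h` supplies; all other
junctions persist. Hence cochains can be restricted to closed tuples without disturbing the cocycle
identity. -/
theorem composable_dropAt {l m i : ℕ} (hi : i ≤ m) {v : ℕ → ZMod l} {a : ℕ → ℕ}
    (h : v (i + 1) = v i + a i) :
    Composable m (dropAt i v) (mergeAt i a) ↔ Composable (m + 1) v a := by
  have key : ∀ j, j ≤ m → dropAt i v j + (mergeAt i a j : ℕ) = v (if j < i then j else j + 1)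
      + (a (if j < i then j else j + 1) : ℕ) := by
    intro j _
    rcases lt_trichotomy j i with hj | rfl | hj
    · simp [dropAt, mergeAt, hj, hj.le]
    · simp [dropAt, mergeAt, h, add_assoc]
    · simp [dropAt, mergeAt, hj.not_ge, hj.not_gt, hj.ne']
  unfold Composable
  rw [key m le_rfl, if_neg (by omega), show dropAt i v 0 = v 0 by simp [dropAt]]
  refine and_congr_left fun _ => ⟨fun H j hj => ?_, fun H j hj => ?_⟩
  · rcases lt_trichotomy j i with hji | rfl | hji
    · have := H j (by omega)
      rw [key j (by omega), if_pos hji] at this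
      simpa [dropAt, show j + 1 ≤ i by omega] using this
    · exact h
    · obtain ⟨j, rfl⟩ : ∃ j', j = j' + 1 := ⟨j - 1, by omega⟩
      have := H j (by omega)
      rw [key j (by omega), if_neg (by omega)] at this
      simpa [dropAt, show ¬ j + 1 ≤ i by omega] using this
  · rw [key j hj.le]
    split_ifs with hji
    · simpa [dropAt, show j + 1 ≤ i by omega] using H j (by omega)
    · simpa [dropAt, show ¬ j + 1 ≤ i by omega] using H (j + 1) (by omega)

theorem composable_setZero {l m : ℕ} {v : ℕ → ZMod l} {a : ℕ → ℕ}
    (h : v 0 = v (m + 1) + a (m + 1)) :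
    Composable m (setZero (v (m + 1)) v) (setZero (a (m + 1) + a 0) a) ↔
      Composable (m + 1) v a := by
  unfold Composable
  have h0 : setZero (v (m + 1)) v 0 + (setZero (a (m + 1) + a 0) a 0 : ℕ) = v 0 + (a 0 : ℕ) := by
    simp [setZero, h, add_assoc]
  have hs : ∀ j, setZero (v (m + 1)) v j + (setZero (a (m + 1) + a 0) a j : ℕ) =
      v j + (a j : ℕ) := by
    rintro (_ | j)
    · exact h0
    · simp [setZero]
  simp only [hs]
  constructor
  · rintro ⟨H, H'⟩
    refine ⟨fun j hj => ?_, h⟩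
    rcases Nat.lt_succ_iff_lt_or_eq.1 hj with hj | rfl
    · simpa [setZero] using H j hj
    · simpa [setZero] using H'
  · rintro ⟨H, -⟩
    exact ⟨fun j hj => by simpa [setZero] using H j (by omega),
      by simpa [setZero] using H m (by omega)⟩

theorem sum_mergeAt {m i : ℕ} (hi : i ≤ m) (a : ℕ → ℕ) :
    ∑ j ∈ Finset.range (m + 1), mergeAt i a j = ∑ j ∈ Finset.range (m + 2), a j := by
  induction m, hi using Nat.le_induction with
  | base =>
    rw [Finset.sum_range_succ, Finset.sum_range_succ, Finset.sum_range_succ, add_assoc]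
    congr 1
    · exact Finset.sum_congr rfl fun j hj => by simp [mergeAt, Finset.mem_range.1 hj]
    · simp [mergeAt]
  | succ m hm ih =>
    rw [Finset.sum_range_succ, ih, Finset.sum_range_succ _ (m + 2)]
    congr 1
    simp [mergeAt, show ¬ m + 1 < i by omega, show m + 1 ≠ i by omega]

theorem sum_setZero (m : ℕ) (a : ℕ → ℕ) :
    ∑ j ∈ Finset.range (m + 1), setZero (a (m + 1) + a 0) a j =
      ∑ j ∈ Finset.range (m + 2), a j := by
  rw [Finset.sum_range_succ' _ m, Finset.sum_range_succ _ (m + 1), Finset.sum_range_succ' _ m]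
  simp [setZero]
  ring

/-! ### Pair indicators and the two cocycle identities -/

variable {k : Type w} [Field k]

/-- The indicator that `n ≤ b (2 i) + b (2 i + 1)` for all `i < c`. -/
def pairInd (k : Type w) [Field k] (n c : ℕ) (b : ℕ → ℕ) : k :=
  ∏ i ∈ Finset.range c, if n ≤ b (2 * i) + b (2 * i + 1) then 1 else 0

theorem pairInd_congr {n c : ℕ} {b b' : ℕ → ℕ} (h : ∀ j < 2 * c, b j = b' j) :
    pairInd k n c b = pairInd k n c b' :=
  Finset.prod_congr rfl fun i hi => by
    rw [Finset.mem_range] at hi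
    rw [h (2 * i) (by omega), h (2 * i + 1) (by omega)]

/-- A nonzero indicator uses up length `c * n`; this bounds the length left for the entries outside
the pairs. -/
theorem pairInd_eq_zero_or (n c : ℕ) (b : ℕ → ℕ) :
    pairInd k n c b = 0 ∨ c * n ≤ ∑ j ∈ Finset.range (2 * c), b j := by
  induction c with
  | zero => simp
  | succ c ih =>
    rw [pairInd, Finset.prod_range_succ, ← pairInd, show 2 * (c + 1) = 2 * c + 1 + 1 by ring,
      Finset.sum_range_succ, Finset.sum_range_succ]
    split_ifs with h
    · refine ih.imp (by simp +contextual) fun ih => ?_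
      linarith
    · simp

/-- Induction on the number of pairs: merges to the left of the last pair contribute the inductive
value times the last indicator, and the two new merges exchange one pairing of the last three
entries for the other. -/
theorem sum_pairInd_mergeAt (n c : ℕ) (b : ℕ → ℕ) :
    ∑ j ∈ Finset.range (2 * c), (-1 : k) ^ j *
      (if b j + b (j + 1) < n then pairInd k n c (mergeAt j b) else 0) =
    pairInd k n c (fun j => b (j + 1)) - pairInd k n c b := by
  induction c with
  | zero => simp [pairInd]
  | succ c ih =>
    have e : ∀ f, pairInd k n (c + 1) f =
        pairInd k n c f * if n ≤ f (2 * c) + f (2 * c + 1) then 1 else 0 := fun f =>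
      Finset.prod_range_succ _ _
    rw [show 2 * (c + 1) = 2 * c + 1 + 1 by ring, Finset.sum_range_succ, Finset.sum_range_succ]
    have h1 : ∑ j ∈ Finset.range (2 * c), (-1 : k) ^ j *
        (if b j + b (j + 1) < n then pairInd k n (c + 1) (mergeAt j b) else 0) =
        (pairInd k n c (fun j => b (j + 1)) - pairInd k n c b) *
          if n ≤ b (2 * c + 1) + b (2 * c + 2) then 1 else 0 := by
      rw [← ih, Finset.sum_mul]
      refine Finset.sum_congr rfl fun j hj => ?_
      rw [Finset.mem_range] at hj
      rw [e, mul_assoc, ite_mul, zero_mul]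
      simp [mergeAt, show ¬ 2 * c < j by omega, show 2 * c ≠ j by omega,
        show ¬ 2 * c + 1 < j by omega, show 2 * c + 1 ≠ j by omega]
    have h2 : pairInd k n c (mergeAt (2 * c) b) = pairInd k n c b :=
      pairInd_congr fun j hj => by simp [mergeAt, hj]
    have h3 : pairInd k n c (mergeAt (2 * c + 1) b) = pairInd k n c b :=
      pairInd_congr fun j hj => by simp [mergeAt, show j < 2 * c + 1 by omega]
    rw [h1, e, e, e, e, h2, h3, pow_succ, pow_mul]
    simp only [mergeAt]
    generalize pairInd k n c b = X
    generalize pairInd k n c (fun j => b (j + 1)) = Y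
    simp only [lt_self_iff_false, if_false, if_true, show ¬ 2 * c + 1 < 2 * c by omega,
      show 2 * c + 1 ≠ 2 * c by omega, show 2 * c < 2 * c + 1 by omega]
    -- With `A`, `B`, `T` the indicators that the first two, the last two, and all three of these
    -- entries sum to at least `n`, the new terms give `T(1 - A) - T(1 - B) = B - A`, as `A` or `B`
    -- forces `T`.
    by_cases hA : n ≤ b (2 * c) + b (2 * c + 1) <;>
      by_cases hB : n ≤ b (2 * c + 1) + b (2 * c + 2)
    · simp [hA, hB, hA.not_gt, hB.not_gt]
    · have : n ≤ b (2 * c) + (b (2 * c + 1) + b (2 * c + 2)) := by omega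
      simp [hA, hB, hA.not_gt, not_le.1 hB, this]
    · have : n ≤ b (2 * c) + b (2 * c + 1) + b (2 * c + 2) := by omega
      simp [hA, hB, hB.not_gt, not_le.1 hA, this]
    · simp only [hA, hB, not_le.1 hA, not_le.1 hB, add_assoc]
      split_ifs <;> simp

theorem mergeAt_succ_succ (i : ℕ) (a : ℕ → ℕ) (j : ℕ) :
    mergeAt (i + 1) a (j + 1) = mergeAt i (fun t => a (t + 1)) j := by
  simp [mergeAt]

/-- The cochain ignores entry 0, so the faces not involving it telescope to the difference of two
shifted indicators, which the first and last faces cancel. -/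
theorem evenCochain_closed {n c q : ℕ} (hq : q < (c + 1) * n) (a : ℕ → ℕ)
    (ha : ∑ j ∈ Finset.range (2 * c + 2), a j = q) :
    ∑ i ∈ Finset.range (2 * c + 1), (-1 : k) ^ i * (if a i + a (i + 1) < n then
        pairInd k n c (fun j => mergeAt i a (j + 1)) else 0) +
      (-1) ^ (2 * c + 1) * (if a (2 * c + 1) + a 0 < n then
        pairInd k n c (fun j => setZero (a (2 * c + 1) + a 0) a (j + 1)) else 0) = 0 := by
  have h := sum_pairInd_mergeAt (k := k) n c (fun t => a (t + 1))
  rw [Finset.sum_range_succ']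
  have e : ∀ i, (fun j => mergeAt (i + 1) a (j + 1)) = mergeAt i (fun t => a (t + 1)) :=
    fun i => funext (mergeAt_succ_succ i a)
  simp only [e, pow_succ, mul_neg, mul_one, neg_mul, Finset.sum_neg_distrib, h]
  have e0 : (fun j => mergeAt 0 a (j + 1)) = fun j => a (j + 1 + 1) := by
    funext j; simp [mergeAt]
  have e1 : (fun j => setZero (a (2 * c + 1) + a 0) a (j + 1)) = fun j => a (j + 1) := by
    funext j; simp [setZero]
  rw [e0, e1, pow_mul]
  -- The truncation condition is automatic: a nonzero indicator leaves less than `n` of the total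
  -- length `q < (c + 1) * n` for the two entries outside it.
  have p0 : (if a 0 + a (0 + 1) < n then pairInd k n c (fun j => a (j + 1 + 1)) else 0) =
      pairInd k n c (fun j => a (j + 1 + 1)) := by
    split_ifs with hlt
    · rfl
    · rcases pairInd_eq_zero_or (k := k) n c (fun j => a (j + 1 + 1)) with h0 | h0
      · exact h0.symm
      · rw [Finset.sum_range_succ', Finset.sum_range_succ'] at ha
        exfalso; linarith
  have p1 : (if a (2 * c + 1) + a 0 < n then pairInd k n c (fun j => a (j + 1)) else 0) =
      pairInd k n c (fun j => a (j + 1)) := by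
    split_ifs with hlt
    · rfl
    · rcases pairInd_eq_zero_or (k := k) n c (fun j => a (j + 1)) with h0 | h0
      · exact h0.symm
      · rw [Finset.sum_range_succ, Finset.sum_range_succ'] at ha
        exfalso; linarith
  rw [p0, p1]
  simp

/-- Faces from index 2 on leave entry 1 alone and telescope. What remains multiplies the shifted
indicator by the coboundary of `g(start) - g(end)`, which vanishes since that weight is additive
under concatenation. -/
theorem oddCochain_closed {l n c : ℕ} (g : ZMod l → k) (hg : ∀ x, g (x + n) = g x)
    (v : ℕ → ZMod l) (a : ℕ → ℕ) (hv : Composable (2 * c + 2) v a)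
    (ha : ∑ j ∈ Finset.range (2 * c + 3), a j = (c + 1) * n) :
    ∑ i ∈ Finset.range (2 * c + 2), (-1 : k) ^ i * (if a i + a (i + 1) < n then
        (g (dropAt i v 1) - g (dropAt i v 1 + mergeAt i a 1)) *
          pairInd k n c (fun j => mergeAt i a (j + 2)) else 0) +
      (-1) ^ (2 * c + 2) * (if a (2 * c + 2) + a 0 < n then
        (g (setZero (v (2 * c + 2)) v 1) - g (setZero (v (2 * c + 2)) v 1 +
          setZero (a (2 * c + 2) + a 0) a 1)) *
          pairInd k n c (fun j => setZero (a (2 * c + 2) + a 0) a (j + 2)) else 0) = 0 := by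
  have h := congrArg (fun x => (g (v 1) - g (v 1 + a 1)) * x)
    (sum_pairInd_mergeAt (k := k) n c (fun t => a (t + 2)))
  simp only [Finset.mul_sum] at h
  rw [Finset.sum_range_succ', Finset.sum_range_succ']
  have e : ∀ i, (fun j => mergeAt (i + 1 + 1) a (j + 2)) = mergeAt i (fun t => a (t + 2)) :=
    fun i => funext fun j => by
      rw [show j + 2 = (j + 1) + 1 from rfl, mergeAt_succ_succ, mergeAt_succ_succ]
  have e0 : (fun j => mergeAt 0 a (j + 2)) = fun j => a (j + 3) := by
    funext j; simp [mergeAt]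
  have e1 : (fun j => mergeAt (0 + 1) a (j + 2)) = fun j => a (j + 3) := by
    funext j; simp [mergeAt]
  have e2 : (fun j => setZero (a (2 * c + 2) + a 0) a (j + 2)) = fun j => a (j + 2) := by
    funext j; simp [setZero]
  have h' : ∑ i ∈ Finset.range (2 * c), (-1 : k) ^ (i + 1 + 1) *
      (if a (i + 1 + 1) + a (i + 1 + 1 + 1) < n then
        (g (dropAt (i + 1 + 1) v 1) - g (dropAt (i + 1 + 1) v 1 + mergeAt (i + 1 + 1) a 1)) *
          pairInd k n c (fun j => mergeAt (i + 1 + 1) a (j + 2)) else 0) =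
      (g (v 1) - g (v 1 + a 1)) * (pairInd k n c (fun j => a (j + 3)) -
        pairInd k n c (fun j => a (j + 2))) := by
    rw [← h]
    refine Finset.sum_congr rfl fun i _ => ?_
    rw [e]
    simp only [dropAt, mergeAt, show (1 : ℕ) ≤ i + 1 + 1 by omega,
      show (1 : ℕ) < i + 1 + 1 by omega, if_true]
    split_ifs <;> ring
  rw [h', e0, e1, e2]
  have hsum0 := ha
  rw [Finset.sum_range_succ', Finset.sum_range_succ', Finset.sum_range_succ'] at hsum0
  have hsum1 := ha
  rw [Finset.sum_range_succ, Finset.sum_range_succ', Finset.sum_range_succ'] at hsum1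
  have v1 : v 1 = v 0 + a 0 := hv.1 0 (by omega)
  have v2 : v 2 = v 1 + a 1 := hv.1 1 (by omega)
  -- A nonzero indicator leaves exactly at most `n` for entries 0, 1, 2; if the product is
  -- truncated, then `a 2 = 0` and the weight vanishes anyway.
  have z0 : (if a 0 + a (0 + 1) < n then (g (dropAt 0 v 1) - g (dropAt 0 v 1 + mergeAt 0 a 1)) *
      pairInd k n c (fun j => a (j + 3)) else 0) =
      (g (v 2) - g (v 2 + a 2)) * pairInd k n c (fun j => a (j + 3)) := by
    split_ifs with hlt
    · simp [dropAt, mergeAt]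
    · rcases pairInd_eq_zero_or (k := k) n c (fun j => a (j + 3)) with h0 | h0
      · rw [h0, mul_zero]
      · have : a 2 = 0 := by linarith
        simp [this]
  -- Here truncation forces the merged length to be exactly `n`, and the weight vanishes by
  -- periodicity of `g`.
  have z1 : (if a (0 + 1) + a (0 + 1 + 1) < n then
      (g (dropAt (0 + 1) v 1) - g (dropAt (0 + 1) v 1 + mergeAt (0 + 1) a 1)) *
      pairInd k n c (fun j => a (j + 3)) else 0) =
      (g (v 1) - g (v 1 + a 1 + a 2)) * pairInd k n c (fun j => a (j + 3)) := by
    split_ifs with hlt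
    · simp [dropAt, mergeAt, add_assoc]
    · rcases pairInd_eq_zero_or (k := k) n c (fun j => a (j + 3)) with h0 | h0
      · rw [h0, mul_zero]
      · have : a 1 + a 2 = n := by
          refine le_antisymm ?_ (not_lt.1 hlt)
          linarith
        rw [add_assoc, ← Nat.cast_add, this, hg, sub_self, zero_mul]
  have z2 : (if a (2 * c + 2) + a 0 < n then
      (g (setZero (v (2 * c + 2)) v 1) - g (setZero (v (2 * c + 2)) v 1 +
          setZero (a (2 * c + 2) + a 0) a 1)) * pairInd k n c (fun j => a (j + 2)) else 0) =
      (g (v 1) - g (v 1 + a 1)) * pairInd k n c (fun j => a (j + 2)) := by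
    split_ifs with hlt
    · simp [setZero]
    · rcases pairInd_eq_zero_or (k := k) n c (fun j => a (j + 2)) with h0 | h0
      · rw [h0, mul_zero]
      · have : a 1 = 0 := by linarith
        simp [this]
  rw [z0, z1, z2, v2, show 2 * c + 2 = 2 * (c + 1) by ring, pow_mul]
  simp only [zero_add, pow_zero, pow_one, even_two, Even.neg_pow, one_pow]
  ring

end CycleCochain

/-! ### Detecting nonzero Hochschild homology -/

/-- A form killing boundaries descends to homology, so a cycle on which it is nonzero is not a
boundary. -/
theorem hochschildHomologyRank_ne_zero {k : Type w} [Field k] {A : Type u} [Ring A] [Algebra k A]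
    {m : ℕ} (φ : (⨂[k] _ : Fin (m + 1), A) →ₗ[k] k) (hφ : φ ∘ₗ hochschildB k A m = 0)
    {z : ⨂[k] _ : Fin (m + 1), A} (hz : z ∈ hochschildCycles k A m) (hne : φ z ≠ 0) :
    hochschildHomologyRank k A m ≠ 0 := by
  intro h0
  have := rank_zero_iff.1 h0
  have h1 : (Submodule.Quotient.mk ⟨z, hz⟩ : HochschildHomology k A m) = 0 :=
    Subsingleton.elim _ _
  rw [Submodule.Quotient.mk_eq_zero] at h1
  obtain ⟨y, hy⟩ := h1
  exact hne (by rw [← show hochschildB k A m y = z from hy]; exact LinearMap.congr_fun hφ y)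

theorem hochschildHomologyDim_eq_top {k : Type w} [Field k] {A : Type u} [Ring A] [Algebra k A]
    (h : ∀ m, ∃ i > m, hochschildHomologyRank k A i ≠ 0) : hochschildHomologyDim k A = ⊤ := by
  simp only [hochschildHomologyDim, iInf_eq_top]
  intro m hm
  obtain ⟨i, hi, hne⟩ := h m
  exact absurd (hm i hi) hne

/-- A family `E x a` of elements of an algebra multiplies like the paths of a cyclic quiver with
`l` vertices modulo the paths of length at least `n`, where `E x a` stands for the path of length
`a` starting at `x`. -/
structure IsTruncatedCycleFamily {A : Type u} [Ring A] (l n : ℕ) (E : ZMod l → ℕ → A) :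
    Prop where
  eq_zero : ∀ x a, n ≤ a → E x a = 0
  mul : ∀ x a y c, E x a * E y c = if y = x + a then E x (a + c) else 0

open CycleCochain

/-! ### Tensors of paths and linear forms on the Hochschild complex -/

namespace IsTruncatedCycleFamily

variable {k : Type w} [Field k] {A : Type u} [Ring A] [Algebra k A] {l n : ℕ}
  {E : ZMod l → ℕ → A}

/-- The pure tensor `E (v 0) (a 0) ⊗ ⋯ ⊗ E (v m) (a m)`. -/
noncomputable def pathTensor (k : Type w) [Field k] {A : Type u} [Ring A] [Algebra k A] {l : ℕ}
    (E : ZMod l → ℕ → A) (m : ℕ) (v : ℕ → ZMod l) (a : ℕ → ℕ) : ⨂[k] _ : Fin (m + 1), A :=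
  PiTensorProduct.tprod k fun j => E (v j) (a j)

theorem hochschildFaceLin_pathTensor (hE : IsTruncatedCycleFamily l n E)
    {m i : ℕ} (hi : i < m + 1) (v : ℕ → ZMod l) (a : ℕ → ℕ) :
    hochschildFaceLin k A m ⟨i, by omega⟩ (pathTensor k E (m + 1) v a) =
      if v (i + 1) = v i + a i then pathTensor k E m (dropAt i v) (mergeAt i a) else 0 := by
  have hl : (⟨i, by omega⟩ : Fin (m + 2)) ≠ Fin.last (m + 1) := fun h => by
    have := congrArg Fin.val h
    simp at this
    omega
  have hf : hochschildFaceLin k A m ⟨i, by omega⟩ (pathTensor k E (m + 1) v a) =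
      PiTensorProduct.tprod k (hochschildFace m ⟨i, by omega⟩
        fun j : Fin (m + 2) => E (v j) (a j)) := PiTensorProduct.lift.tprod _
  rw [hf]
  split_ifs with h
  · refine congrArg _ (funext fun j => ?_)
    rcases lt_trichotomy (j : ℕ) i with hj | hj | hj
    · simp [hochschildFace, hl, Fin.lt_def, dropAt, mergeAt, hj, hj.le]
    · simp [hochschildFace, hl, Fin.lt_def, Fin.ext_iff, dropAt, mergeAt, hj, hE.mul, h]
    · simp [hochschildFace, hl, Fin.lt_def, Fin.ext_iff, dropAt, mergeAt, hj.not_gt, hj.ne',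
        hj.not_ge]
  · refine (PiTensorProduct.tprod k).map_coord_zero ⟨i, hi⟩ ?_
    simp [hochschildFace, hl, hE.mul, h]

theorem hochschildFaceLin_last_pathTensor (hE : IsTruncatedCycleFamily l n E)
    {m : ℕ} (v : ℕ → ZMod l) (a : ℕ → ℕ) :
    hochschildFaceLin k A m (Fin.last (m + 1)) (pathTensor k E (m + 1) v a) =
      if v 0 = v (m + 1) + a (m + 1) then
        pathTensor k E m (setZero (v (m + 1)) v) (setZero (a (m + 1) + a 0) a) else 0 := by
  have hf : hochschildFaceLin k A m (Fin.last (m + 1)) (pathTensor k E (m + 1) v a) =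
      PiTensorProduct.tprod k (hochschildFace m (Fin.last (m + 1))
        fun j : Fin (m + 2) => E (v j) (a j)) := PiTensorProduct.lift.tprod _
  rw [hf]
  split_ifs with h
  · refine congrArg _ (funext fun j => ?_)
    by_cases hj : j = 0
    · subst hj
      simp [hochschildFace, setZero, hE.mul, h]
    · simp [hochschildFace, setZero, hj]
  · refine (PiTensorProduct.tprod k).map_coord_zero 0 ?_
    simp [hochschildFace, hE.mul, h]

theorem pathTensor_eq_zero (hE : IsTruncatedCycleFamily l n E)
    {m j : ℕ} (hj : j < m + 1) (v : ℕ → ZMod l) {a : ℕ → ℕ}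
    (h : n ≤ a j) : pathTensor k E m v a = 0 :=
  (PiTensorProduct.tprod k).map_coord_zero ⟨j, hj⟩ (hE.eq_zero _ _ h)

theorem pathTensor_mem_hochschildCycles (hE : IsTruncatedCycleFamily l n E)
    {m : ℕ} (v : ℕ → ZMod l) (a : ℕ → ℕ)
    (h : ∀ i < m + 1, n ≤ a i + a (i + 1)) (h' : n ≤ a (m + 1) + a 0) :
    pathTensor k E (m + 1) v a ∈ hochschildCycles k A (m + 1) := by
  change hochschildB k A m _ = 0
  rw [hochschildB, LinearMap.sum_apply]
  refine Finset.sum_eq_zero fun i _ => ?_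
  rw [LinearMap.smul_apply]
  convert smul_zero _
  rcases Fin.eq_castSucc_or_eq_last i with ⟨i, rfl⟩ | rfl
  · refine (hE.hochschildFaceLin_pathTensor i.2 v a).trans ?_
    split_ifs
    · exact hE.pathTensor_eq_zero i.2 _ (by simpa [mergeAt] using h i i.2)
    · rfl
  · rw [hE.hochschildFaceLin_last_pathTensor]
    split_ifs
    · exact hE.pathTensor_eq_zero (Nat.succ_pos m) _ (by simpa [setZero] using h')
    · rfl

/-- The linear form on `A^{⊗ m+1}` with value `W v a` at the basis vector `pathTensor k E m v a`. -/
noncomputable def cochain (b : Module.Basis (ZMod l × Fin n) k A) (m : ℕ)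
    (W : (ℕ → ZMod l) → (ℕ → ℕ) → k) : (⨂[k] _ : Fin (m + 1), A) →ₗ[k] k :=
  (Basis.piTensorProduct fun _ => b).constr k fun τ =>
    W (fun j => (τ (Fin.ofNat (m + 1) j)).1) (fun j => (τ (Fin.ofNat (m + 1) j)).2)

variable {b : Module.Basis (ZMod l × Fin n) k A} {m : ℕ} {W : (ℕ → ZMod l) → (ℕ → ℕ) → k}

/-- A basis index determines only entries `0, …, m`, and `Fin.ofNat` continues them periodically;
`hW` makes this continuation irrelevant. -/
theorem cochain_pathTensor (hb : ∀ p, b p = E p.1 p.2)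
    (hW : ∀ v v' a a', (∀ j ≤ m, v j = v' j) → (∀ j ≤ m, a j = a' j) → W v a = W v' a')
    (v : ℕ → ZMod l) (a : ℕ → ℕ) (ha : ∀ j ≤ m, a j < n) :
    cochain b m W (pathTensor k E m v a) = W v a := by
  have : pathTensor k E m v a = Basis.piTensorProduct (fun _ : Fin (m + 1) => b)
      (fun j => (v j, ⟨a j, ha j (Nat.lt_succ_iff.1 j.2)⟩)) := by
    rw [Basis.piTensorProduct_apply]
    simp only [hb]
    rfl
  rw [this, cochain, Module.Basis.constr_basis]
  refine hW _ _ _ _ (fun j hj => ?_) (fun j hj => ?_) <;>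
    simp [Nat.mod_eq_of_lt (Nat.lt_succ_of_le hj)]

/-- The cocycle condition is checked on basis tensors. The conditions on lengths are needed because
`W` may be nonzero on a merged tuple whose tensor vanishes by truncation. -/
theorem cochain_comp_hochschildB (hE : IsTruncatedCycleFamily l n E) (hb : ∀ p, b p = E p.1 p.2)
    (hW : ∀ v v' a a', (∀ j ≤ m, v j = v' j) → (∀ j ≤ m, a j = a' j) → W v a = W v' a')
    (h : ∀ (v : ℕ → ZMod l) (a : ℕ → ℕ), (∀ j ≤ m + 1, a j < n) →
      ∑ i ∈ Finset.range (m + 1), (-1 : k) ^ i * (if v (i + 1) = v i + a i ∧ a i + a (i + 1) < n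
        then W (dropAt i v) (mergeAt i a) else 0) +
      (-1) ^ (m + 1) * (if v 0 = v (m + 1) + a (m + 1) ∧ a (m + 1) + a 0 < n then
        W (setZero (v (m + 1)) v) (setZero (a (m + 1) + a 0) a) else 0) = 0) :
    cochain b m W ∘ₗ hochschildB k A m = 0 := by
  refine (Basis.piTensorProduct fun _ : Fin (m + 2) => b).ext fun τ => ?_
  set v : ℕ → ZMod l := fun j => (τ (Fin.ofNat (m + 2) j)).1 with hv
  set a : ℕ → ℕ := fun j => (τ (Fin.ofNat (m + 2) j)).2 with ha
  have hτ : Basis.piTensorProduct (fun _ : Fin (m + 2) => b) τ = pathTensor k E (m + 1) v a := by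
    rw [Basis.piTensorProduct_apply]
    simp only [hb, pathTensor, hv, ha]
    simp
  have han : ∀ j, a j < n := fun j => (τ (Fin.ofNat (m + 2) j)).2.2
  rw [hτ, LinearMap.zero_apply, ← h v a fun j _ => han j, LinearMap.comp_apply, hochschildB,
    LinearMap.sum_apply, map_sum, Fin.sum_univ_castSucc, ← Fin.sum_univ_eq_sum_range]
  congr 1
  · refine Finset.sum_congr rfl fun i _ => ?_
    rw [LinearMap.smul_apply, map_smul, smul_eq_mul]
    refine congrArg _ ?_
    refine (congrArg _ (hE.hochschildFaceLin_pathTensor i.2 v a)).trans ?_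
    rw [ite_and, apply_ite (cochain b m W), map_zero]
    refine if_congr Iff.rfl ?_ rfl
    split_ifs with hlt
    · refine cochain_pathTensor hb hW _ _ fun j hj => ?_
      unfold mergeAt
      split_ifs <;> first | exact hlt | exact han _
    · rw [hE.pathTensor_eq_zero i.2 _ (by simpa [mergeAt] using hlt), map_zero]
  · rw [LinearMap.smul_apply, map_smul, smul_eq_mul]
    refine congrArg _ ?_
    rw [hE.hochschildFaceLin_last_pathTensor, ite_and, apply_ite (cochain b m W), map_zero]
    refine if_congr Iff.rfl ?_ rfl
    split_ifs with hlt
    · refine cochain_pathTensor hb hW _ _ fun j hj => ?_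
      unfold setZero
      split_ifs <;> first | exact hlt | exact han _
    · rw [hE.pathTensor_eq_zero (Nat.succ_pos m) _ (by simpa [setZero] using hlt), map_zero]

end IsTruncatedCycleFamily

/-! ### Restriction to closed tuples of fixed total length -/

namespace CycleCochain

variable {k : Type w} [Field k] {l : ℕ}

open Classical in
/-- The restriction of a function of tuples to the tuples of paths which compose to a closed path
of length `q`. -/
noncomputable def onClosed (m q : ℕ) (U : (ℕ → ZMod l) → (ℕ → ℕ) → k) (v : ℕ → ZMod l)
    (a : ℕ → ℕ) : k :=
  if Composable m v a ∧ ∑ j ∈ Finset.range (m + 1), a j = q then U v a else 0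

theorem onClosed_congr {m q : ℕ} {U : (ℕ → ZMod l) → (ℕ → ℕ) → k}
    (hU : ∀ v v' a a', (∀ j ≤ m, v j = v' j) → (∀ j ≤ m, a j = a' j) → U v a = U v' a')
    (v v' : ℕ → ZMod l) (a a' : ℕ → ℕ) (hv : ∀ j ≤ m, v j = v' j) (ha : ∀ j ≤ m, a j = a' j) :
    onClosed m q U v a = onClosed m q U v' a' := by
  classical
  unfold onClosed
  refine if_congr (and_congr (and_congr (forall₂_congr fun j hj => ?_) ?_) ?_)
    (hU _ _ _ _ hv ha) rfl
  · rw [hv j (by omega), hv (j + 1) (by omega), ha j (by omega)]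
  · rw [hv m le_rfl, hv 0 (Nat.zero_le m), ha m le_rfl]
  · rw [Finset.sum_congr rfl fun j hj => ha j (Nat.lt_succ_iff.1 (Finset.mem_range.1 hj))]

theorem onClosed_closed {n m q : ℕ} {U : (ℕ → ZMod l) → (ℕ → ℕ) → k} (v : ℕ → ZMod l) (a : ℕ → ℕ)
    (h : Composable (m + 1) v a → ∑ j ∈ Finset.range (m + 2), a j = q →
      ∑ i ∈ Finset.range (m + 1), (-1 : k) ^ i * (if a i + a (i + 1) < n
        then U (dropAt i v) (mergeAt i a) else 0) +
      (-1) ^ (m + 1) * (if a (m + 1) + a 0 < n then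
        U (setZero (v (m + 1)) v) (setZero (a (m + 1) + a 0) a) else 0) = 0) :
    ∑ i ∈ Finset.range (m + 1), (-1 : k) ^ i * (if v (i + 1) = v i + a i ∧ a i + a (i + 1) < n
        then onClosed m q U (dropAt i v) (mergeAt i a) else 0) +
      (-1) ^ (m + 1) * (if v 0 = v (m + 1) + a (m + 1) ∧ a (m + 1) + a 0 < n then
        onClosed m q U (setZero (v (m + 1)) v) (setZero (a (m + 1) + a 0) a) else 0) = 0 := by
  by_cases H : Composable (m + 1) v a ∧ ∑ j ∈ Finset.range (m + 2), a j = q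
  · refine Eq.trans ?_ (h H.1 H.2)
    congr 1
    · refine Finset.sum_congr rfl fun i hi => congrArg _ ?_
      have hi' := Finset.mem_range.1 hi
      have hv := H.1.1 i hi'
      rw [onClosed, composable_dropAt (Nat.lt_succ_iff.1 hi') hv,
        sum_mergeAt (Nat.lt_succ_iff.1 hi'), if_pos H]
      simp [hv]
    · refine congrArg _ ?_
      have hv := H.1.2
      rw [onClosed, composable_setZero hv, sum_setZero, if_pos H]
      simp [← hv]
  · rw [Finset.sum_eq_zero, zero_add]
    · split_ifs with hv
      · rw [onClosed, composable_setZero hv.1, sum_setZero, if_neg H, mul_zero]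
      · exact mul_zero _
    · intro i hi
      have hi' := Nat.lt_succ_iff.1 (Finset.mem_range.1 hi)
      split_ifs with hv
      · rw [onClosed, composable_dropAt hi' hv.1, sum_mergeAt hi', if_neg H, mul_zero]
      · exact mul_zero _

end CycleCochain

/-! ### Nonzero classes in even and odd degrees -/

namespace IsTruncatedCycleFamily

variable {k : Type w} [Field k] {A : Type u} [Ring A] [Algebra k A] {l n : ℕ}
  {E : ZMod l → ℕ → A}
  {b : Module.Basis (ZMod l × Fin n) k A}

/-- The vertices passed by successive paths of lengths `a 0, a 1, …`, the second of which starts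
at `0`. -/
def startSeq (l : ℕ) (a : ℕ → ℕ) (j : ℕ) : ZMod l := (∑ i ∈ Finset.range j, a i : ℕ) - (a 0 : ℕ)

theorem composable_startSeq {m : ℕ} {a : ℕ → ℕ} (h : l ∣ ∑ i ∈ Finset.range (m + 1), a i) :
    Composable m (startSeq l a) a := by
  have key : ∀ j, startSeq l a j + a j = startSeq l a (j + 1) := fun j => by
    simp only [startSeq, Finset.sum_range_succ]
    push_cast
    ring
  refine ⟨fun j _ => (key j).symm, ?_⟩
  have hm : startSeq l a (m + 1) = -(a 0 : ZMod l) := by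
    rw [startSeq, (ZMod.natCast_eq_zero_iff _ _).2 h, zero_sub]
  rw [key, hm]
  simp [startSeq]

theorem hochschildHomologyRank_ne_zero_of_cochain (hE : IsTruncatedCycleFamily l n E)
    (hb : ∀ p, b p = E p.1 p.2) {m : ℕ}
    {U : (ℕ → ZMod l) → (ℕ → ℕ) → k} {a : ℕ → ℕ}
    (hU : ∀ v v' a a', (∀ j ≤ m + 1, v j = v' j) → (∀ j ≤ m + 1, a j = a' j) → U v a = U v' a')
    (ha : ∀ j, a j < n) (haa : ∀ i < m + 1, n ≤ a i + a (i + 1)) (ha' : n ≤ a (m + 1) + a 0)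
    (hl : l ∣ ∑ i ∈ Finset.range (m + 2), a i)
    (hcl : ∀ v a', Composable (m + 2) v a' →
      ∑ j ∈ Finset.range (m + 3), a' j = ∑ i ∈ Finset.range (m + 2), a i →
      ∑ i ∈ Finset.range (m + 2), (-1 : k) ^ i * (if a' i + a' (i + 1) < n
        then U (dropAt i v) (mergeAt i a') else 0) +
      (-1) ^ (m + 2) * (if a' (m + 2) + a' 0 < n then
        U (setZero (v (m + 2)) v) (setZero (a' (m + 2) + a' 0) a') else 0) = 0)
    (hne : U (startSeq l a) a ≠ 0) : hochschildHomologyRank k A (m + 1) ≠ 0 := by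
  set q := ∑ i ∈ Finset.range (m + 2), a i with hq
  have hW := onClosed_congr (q := q) hU
  refine hochschildHomologyRank_ne_zero (cochain b (m + 1) (onClosed (m + 1) q U))
    (hE.cochain_comp_hochschildB hb hW fun v a' _ => onClosed_closed v a' (hcl v a'))
    (hE.pathTensor_mem_hochschildCycles (startSeq l a) a haa ha') ?_
  rw [cochain_pathTensor hb hW _ _ fun j _ => ha j, onClosed,
    if_pos ⟨composable_startSeq hl, hq.symm⟩]
  exact hne

theorem hochschildHomologyRank_even_ne_zero (hE : IsTruncatedCycleFamily l n E)
    (hb : ∀ p, b p = E p.1 p.2) (hn : 2 ≤ n) {c : ℕ}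
    (hl : l ∣ (c + 2) * n - 1) : hochschildHomologyRank k A (2 * c + 2) ≠ 0 := by
  -- Entries 1 onward form pairs `(n - 1, 1)` of sum exactly `n`; the extra `n - 1` in front is the
  -- most that the strict bound on total length permits.
  set a : ℕ → ℕ := fun j => if j = 0 then n - 1 else if Odd j then n - 1 else 1 with ha
  have a0 : a 0 = n - 1 := rfl
  have ao : ∀ t, a (2 * t + 1) = n - 1 := fun t => by simp [ha]
  have ae : ∀ t, a (2 * t + 2) = 1 := fun t => by
    simp [ha, show ¬ Odd (2 * t + 2) by rw [Nat.not_odd_iff_even]; exact ⟨t + 1, by ring⟩]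
  have hsum : ∀ c, ∑ i ∈ Finset.range (2 * c + 1), a i = (c + 1) * n - 1 := by
    intro c
    induction c with
    | zero => simp [a0]
    | succ c ih =>
      rw [show 2 * (c + 1) + 1 = 2 * c + 1 + 1 + 1 by ring, Finset.sum_range_succ,
        Finset.sum_range_succ, ih, ao, ae]
      have : n ≤ (c + 1) * n := Nat.le_mul_of_pos_left n (by omega)
      have : (c + 1 + 1) * n = (c + 1) * n + n := by ring
      omega
  have hs := hsum (c + 1)
  rw [show 2 * (c + 1) + 1 = 2 * c + 1 + 2 by ring] at hs
  refine hE.hochschildHomologyRank_ne_zero_of_cochain hb (m := 2 * c + 1)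
    (U := fun _ a => pairInd k n (c + 1) fun j => a (j + 1)) (a := a) ?_ ?_ ?_ ?_ ?_ ?_ ?_
  · exact fun v v' a a' _ h => pairInd_congr fun j hj => h _ (by omega)
  · intro j
    simp only [ha]
    split_ifs <;> omega
  · intro i _
    rcases Nat.even_or_odd' i with ⟨t, rfl | rfl⟩
    · rw [ao]
      rcases t with _ | t
      · rw [mul_zero, a0]; omega
      · rw [show 2 * (t + 1) = 2 * t + 2 by ring, ae]; omega
    · rw [ao, ae]; omega
  · rw [show 2 * c + 1 + 1 = 2 * c + 2 by ring, ae, a0]; omega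
  · rw [hs]; exact hl
  · intro v a' _ hsum'
    rw [hs] at hsum'
    have hpos : 0 < (c + 2) * n := by positivity
    exact evenCochain_closed (c := c + 1) (Nat.sub_lt hpos one_pos) a' hsum'
  · rw [pairInd, Finset.prod_eq_one]
    · exact one_ne_zero
    · intro i _
      rw [ao, ae, if_pos (by omega)]

theorem hochschildHomologyRank_odd_ne_zero (hE : IsTruncatedCycleFamily l n E)
    (hb : ∀ p, b p = E p.1 p.2) (hn : 2 ≤ n) {c : ℕ}
    (hl : l ∣ (c + 1) * n) {g : ZMod l → k} (hg : ∀ x, g (x + n) = g x) (hg' : g 0 ≠ g 1) :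
    hochschildHomologyRank k A (2 * c + 1) ≠ 0 := by
  set a : ℕ → ℕ := fun j => if Odd j then 1 else n - 1 with ha
  have ao : ∀ t, a (2 * t + 1) = 1 := fun t => by simp [ha]
  have ae : ∀ t, a (2 * t) = n - 1 := fun t => by simp [ha]
  have hsum : ∀ c, ∑ i ∈ Finset.range (2 * c), a i = c * n := by
    intro c
    induction c with
    | zero => simp
    | succ c ih =>
      rw [show 2 * (c + 1) = 2 * c + 1 + 1 by ring, Finset.sum_range_succ,
        Finset.sum_range_succ, ih, ao, ae]
      have : (c + 1) * n = c * n + n := by ring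
      omega
  have hs := hsum (c + 1)
  rw [show 2 * (c + 1) = 2 * c + 2 by ring] at hs
  refine hE.hochschildHomologyRank_ne_zero_of_cochain hb (m := 2 * c)
    (U := fun v a => (g (v 1) - g (v 1 + a 1)) * pairInd k n c fun j => a (j + 2)) (a := a)
    ?_ ?_ ?_ ?_ ?_ ?_ ?_
  · intro v v' a a' hv h
    rw [hv 1 (by omega), h 1 (by omega), pairInd_congr fun j hj => h (j + 2) (by omega)]
  · intro j
    simp only [ha]
    split_ifs <;> omega
  · intro i _
    rcases Nat.even_or_odd' i with ⟨t, rfl | rfl⟩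
    · rw [ao, ae]; omega
    · rw [ao, show 2 * t + 1 + 1 = 2 * (t + 1) by ring, ae]; omega
  · rw [ao, show a 0 = n - 1 from ae 0]; omega
  · rw [hs]; exact hl
  · intro v a' hv hsum'
    rw [hs] at hsum'
    exact oddCochain_closed g hg v a' hv hsum'
  · rw [pairInd, Finset.prod_eq_one, mul_one]
    -- `startSeq` is normalised so that entry 1 runs from vertex 0 to vertex 1, giving the weight `g
    -- 0 - g 1`.
    · simpa [startSeq, show a 1 = 1 from ao 0, sub_eq_zero] using hg'
    · intro i _
      rw [show 2 * i + 2 = 2 * (i + 1) by ring, show 2 * i + 1 + 2 = 2 * (i + 1) + 1 by ring, ao,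
        ae, if_pos (by omega)]

/-- An algebra with a basis of paths of a cyclic quiver, truncated at length `n ≥ 2`, has infinite
Hochschild homology dimension. -/
theorem hochschildHomologyDim_eq_top (hE : IsTruncatedCycleFamily l n E)
    (hb : ∀ p, b p = E p.1 p.2) (hn : 2 ≤ n) (hl : 1 ≤ l) :
    hochschildHomologyDim k A = ⊤ := by
  refine _root_.hochschildHomologyDim_eq_top fun m => ?_
  by_cases hnl : n.Coprime l
  · obtain ⟨t, ht⟩ : ∃ t : ℕ, l ∣ (m + t + 2) * n - 1 := by
      have : NeZero l := ⟨by omega⟩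
      have hu := ZMod.coe_mul_inv_eq_one n hnl
      -- Chosen so that `m + t + 2` is inverse to `n` modulo `l`.
      refine ⟨((n : ZMod l)⁻¹ - (m + 2)).val, ?_⟩
      set t := ((n : ZMod l)⁻¹ - (m + 2)).val with htdef
      have hpos : 1 ≤ (m + t + 2) * n := Nat.one_le_iff_ne_zero.2 (by positivity)
      rw [← ZMod.natCast_eq_zero_iff, Nat.cast_sub hpos]
      push_cast
      rw [htdef, ZMod.natCast_zmod_val]
      linear_combination hu
    exact ⟨_, by omega, hE.hochschildHomologyRank_even_ne_zero hb hn ht⟩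
  · set d := n.gcd l with hd
    have hdn : d ∣ n := Nat.gcd_dvd_left n l
    have hdl : d ∣ l := Nat.gcd_dvd_right n l
    have hd2 : 1 < d := by
      have : d ≠ 0 := Nat.gcd_ne_zero_left (by omega)
      have : d ≠ 1 := hnl
      omega
    have : Fact (1 < d) := ⟨hd2⟩
    set f := ZMod.castHom hdl (ZMod d)
    -- This makes the number of pairs a multiple of `l`, so the total length is one too, in a degree
    -- above `m`.
    obtain ⟨c, hc⟩ : ∃ c, m + c + 1 = l * (m + 1) :=
      ⟨l * (m + 1) - (m + 1), by have := Nat.le_mul_of_pos_left (m + 1) hl; omega⟩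
    refine ⟨2 * (m + c) + 1, by omega, hE.hochschildHomologyRank_odd_ne_zero hb hn
      -- The indicator of the multiples of `d` is `n`-periodic as `d ∣ n`, and separates 0 from 1 as
      -- `d > 1`.
      (g := fun x => if f x = 0 then 1 else 0) ?_ ?_ ?_⟩
    · rw [hc, mul_assoc]
      exact Dvd.intro _ rfl
    · intro x
      simp only [map_add, map_natCast, (ZMod.natCast_eq_zero_iff n d).2 hdn, add_zero]
    · simp

end IsTruncatedCycleFamily

/-! ### Paths of a basic cycle -/

section Paths

variable {V : Type u} [Quiver.{v} V] {l : ℕ} {s : ZMod l → V} {a : ∀ i : ZMod l, s i ⟶ s (i + 1)}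

/-- A vertex of a basic cycle is the source of at most one arrow. -/
theorem arrow_unique_of_cycle (hs : Function.Injective s)
    (ha : Function.Surjective (fun i : ZMod l => (⟨s i, s (i + 1), a i⟩ : Quiver.Total V)))
    {x y z : V} (f : x ⟶ y) (g : x ⟶ z) :
    (⟨y, f⟩ : Σ z, x ⟶ z) = ⟨z, g⟩ := by
  obtain ⟨i, hi⟩ := ha ⟨x, y, f⟩
  obtain ⟨j, hj⟩ := ha ⟨x, z, g⟩
  have hij : s i = s j := (congrArg Quiver.Total.left hi).trans (congrArg Quiver.Total.left hj).symm
  obtain rfl := hs hij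
  simpa using hi.symm.trans hj

theorem arrow_end_eq_of_cycle (hs : Function.Injective s)
    (ha : Function.Surjective (fun i : ZMod l => (⟨s i, s (i + 1), a i⟩ : Quiver.Total V)))
    {i : ZMod l} {x y : V} (f : x ⟶ y) (hx : x = s i) : y = s (i + 1) := by
  subst hx
  exact congrArg Sigma.fst (arrow_unique_of_cycle hs ha f (a i))

theorem path_end_eq_of_cycle (hs : Function.Injective s)
    (ha : Function.Surjective (fun i : ZMod l => (⟨s i, s (i + 1), a i⟩ : Quiver.Total V)))
    (i : ZMod l) {y : V} (p : Quiver.Path (s i) y) : y = s (i + p.length) := by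
  induction p with
  | nil => simp
  | cons p f ih =>
    refine (arrow_end_eq_of_cycle hs ha f ih).trans ?_
    rw [Quiver.Path.length_cons, Nat.cast_succ, add_assoc]

/-- Each vertex has only one outgoing arrow, so start and length determine a path step by step. -/
theorem path_unique_of_cycle (hs : Function.Injective s)
    (ha : Function.Surjective (fun i : ZMod l => (⟨s i, s (i + 1), a i⟩ : Quiver.Total V)))
    {x y z : V} (p : Quiver.Path x y) (q : Quiver.Path x z) (h : p.length = q.length) :
    (⟨y, p⟩ : Σ z, Quiver.Path x z) = ⟨z, q⟩ := by
  induction p generalizing z with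
  | nil =>
    obtain rfl := Quiver.Path.eq_of_length_zero q h.symm
    rw [Quiver.Path.eq_nil_of_length_zero q h.symm]
  | @cons y y' p f ih =>
    cases q with
    | nil => simp at h
    | @cons x _ q g =>
      have h' := ih q (by simpa using h)
      obtain rfl : y = x := congrArg Sigma.fst h'
      obtain rfl : p = q := by simpa using h'
      have hfg := arrow_unique_of_cycle hs ha f g
      obtain rfl : y' = z := congrArg Sigma.fst hfg
      obtain rfl : f = g := by simpa using hfg
      rfl

theorem exists_path_of_cycle (a : ∀ i : ZMod l, s i ⟶ s (i + 1)) (i : ZMod l) (m : ℕ) :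
    ∃ (y : V) (p : Quiver.Path (s i) y), y = s (i + m) ∧ p.length = m := by
  induction m with
  | zero => exact ⟨s i, Quiver.Path.nil, by simp, rfl⟩
  | succ m ih =>
    obtain ⟨y, p, rfl, hp⟩ := ih
    exact ⟨_, p.cons (a (i + m)), by rw [Nat.cast_succ, add_assoc], by simp [hp]⟩

/-- The paths of a basic cycle correspond to pairs of a start vertex and a length. -/
theorem IsBasicCycle.exists_equiv (hQ : IsBasicCycle V l) :
    ∃ e : QuiverPath V ≃ ZMod l × ℕ, (∀ p, (e p).2 = p.2.2.length) ∧
      (∀ p q, p.1 = q.1 → (e p).1 = (e q).1) ∧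
      ∀ p q, p.2.1 = q.1 ↔ (e q).1 = (e p).1 + (e p).2 := by
  obtain ⟨-, s, a, hs, ha⟩ := hQ
  let σ := Equiv.ofBijective s hs
  let e : QuiverPath V → ZMod l × ℕ := fun p => (σ.symm p.1, p.2.2.length)
  have he : Function.Bijective e := by
    constructor
    · rintro ⟨x, y, p⟩ ⟨x', z, q⟩ h
      obtain rfl : x = x' := σ.symm.injective (congrArg Prod.fst h)
      exact congrArg (Sigma.mk x) (path_unique_of_cycle hs.1 ha.2 p q (congrArg Prod.snd h))
    · rintro ⟨i, m⟩
      obtain ⟨y, p, -, hp⟩ := exists_path_of_cycle a i m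
      exact ⟨⟨s i, y, p⟩, Prod.ext (σ.symm_apply_apply i) hp⟩
  refine ⟨Equiv.ofBijective e he, fun p => rfl, fun p q h => congrArg σ.symm h, ?_⟩
  rintro ⟨x, y, p⟩ ⟨z, t, q⟩
  obtain ⟨i, rfl⟩ := hs.2 x
  have hy := path_end_eq_of_cycle hs.1 ha.2 i p
  have hi : σ.symm (s i) = i := σ.symm_apply_apply i
  change y = z ↔ σ.symm z = σ.symm (s i) + p.length
  rw [hi, Equiv.symm_apply_eq, eq_comm]
  exact iff_of_eq (congrArg (z = ·) hy)

end Paths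

/-! ### A basis of a truncated quiver algebra -/

namespace PathAlgebra

variable (k : Type w) [Field k] (V : Type u) [Quiver.{v} V]

/-- The basis of the path algebra given by the paths. -/
noncomputable def basis : Module.Basis (QuiverPath V) k (PathAlgebra k V) :=
  (Finsupp.basisSingleOne : Module.Basis (QuiverPath V) k (QuiverPath V →₀ k))

variable {k V}

theorem basis_apply (p : QuiverPath V) : basis k V p = single k p :=
  congrFun Finsupp.coe_basisSingleOne p

variable (k V)

/-- The subspace of the path algebra spanned by the paths of length at least `n`. -/
noncomputable def longPaths (n : ℕ) : Submodule k (PathAlgebra k V) :=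
  Submodule.span k (basis k V '' {p | n ≤ p.2.2.length})

variable {k V} {n : ℕ}

theorem single_mem_longPaths {p : QuiverPath V} (hp : n ≤ p.2.2.length) :
    single k p ∈ longPaths k V n :=
  basis_apply (k := k) p ▸ Submodule.subset_span ⟨p, hp, rfl⟩

theorem exists_pathMul_eq_single {p q : QuiverPath V} (h : p.2.1 = q.1) :
    ∃ r : QuiverPath V, pathMul k p q = single k r ∧ r.1 = p.1 ∧
      r.2.2.length = p.2.2.length + q.2.2.length := by
  obtain ⟨x, y, p⟩ := p
  obtain ⟨z, t, q⟩ := q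
  obtain rfl : y = z := h
  exact ⟨_, dif_pos rfl, rfl, Quiver.Path.length_comp _ _⟩

theorem pathMul_mem_longPaths {p q : QuiverPath V} (h : n ≤ p.2.2.length ∨ n ≤ q.2.2.length) :
    pathMul k p q ∈ longPaths k V n := by
  by_cases hpq : p.2.1 = q.1
  · obtain ⟨r, hr, -, hl⟩ := exists_pathMul_eq_single (k := k) hpq
    rw [hr]
    exact single_mem_longPaths (by omega)
  · rw [pathMul, dif_neg hpq]
    exact zero_mem _

variable [Fintype V]

theorem mul_mem_longPaths_right (x : PathAlgebra k V) {y : PathAlgebra k V}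
    (hy : y ∈ longPaths k V n) : x * y ∈ longPaths k V n := by
  have hx : x ∈ Submodule.span k (Set.range (basis k V)) := (basis k V).mem_span x
  have := Submodule.mul_mem_mul hx hy
  rw [longPaths, Submodule.span_mul_span] at this
  refine Submodule.span_le.2 ?_ this
  rintro _ ⟨_, ⟨p, rfl⟩, _, ⟨q, hq, rfl⟩, rfl⟩
  simp only [basis_apply, single_mul_single]
  exact pathMul_mem_longPaths (Or.inr hq)

theorem mul_mem_longPaths_left {x : PathAlgebra k V} (y : PathAlgebra k V)
    (hx : x ∈ longPaths k V n) : x * y ∈ longPaths k V n := by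
  have hy : y ∈ Submodule.span k (Set.range (basis k V)) := (basis k V).mem_span y
  have := Submodule.mul_mem_mul hx hy
  rw [longPaths, Submodule.span_mul_span] at this
  refine Submodule.span_le.2 ?_ this
  rintro _ ⟨_, ⟨p, hp, rfl⟩, _, ⟨q, rfl⟩, rfl⟩
  simp only [basis_apply, single_mul_single]
  exact pathMul_mem_longPaths (Or.inl hp)

/-- The span of the long paths is already a two-sided ideal containing the generators. This bounds
the kernel of the quotient map, so the short paths stay independent. -/
theorem mem_longPaths_of_mem_truncationIdeal {x : PathAlgebra k V}
    (hx : x ∈ truncationIdeal k V n) : x ∈ longPaths k V n := by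
  let J : TwoSidedIdeal (PathAlgebra k V) := TwoSidedIdeal.mk' (longPaths k V n : Set _)
    (zero_mem _) add_mem neg_mem (mul_mem_longPaths_right _) (mul_mem_longPaths_left _)
  have hJ : truncationIdeal k V n ≤ J := by
    refine TwoSidedIdeal.span_le.2 ?_
    rintro _ ⟨p, hp, rfl⟩
    exact (TwoSidedIdeal.mem_mk' _ _ _ _ _ _ _).2 (single_mem_longPaths hp)
  exact (TwoSidedIdeal.mem_mk' _ _ _ _ _ _ _).1 (hJ hx)

end PathAlgebra

namespace TruncatedQuiverAlgebra

open PathAlgebra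

variable (k : Type w) [Field k] (V : Type u) [Quiver.{v} V] [Fintype V] (n : ℕ)

/-- The quotient map from the path algebra to the truncated quiver algebra. -/
noncomputable def mk : PathAlgebra k V →ₐ[k] TruncatedQuiverAlgebra k V n :=
  (truncationIdeal k V n).ringCon.mkₐ k

variable {k V n}

theorem mk_eq_zero_iff {x : PathAlgebra k V} : mk k V n x = 0 ↔ x ∈ truncationIdeal k V n := by
  rw [TwoSidedIdeal.mem_iff]
  exact RingCon.eq _

theorem mk_single_eq_zero {p : QuiverPath V} (hp : n ≤ p.2.2.length) :
    mk k V n (single k p) = 0 :=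
  mk_eq_zero_iff.2 (TwoSidedIdeal.subset_span ⟨p, hp, rfl⟩)

/-- The classes of the paths of length less than `n` are linearly independent in the truncated
quiver algebra. -/
theorem linearIndependent_mk_single :
    LinearIndependent k fun p : {p : QuiverPath V // p.2.2.length < n} =>
      mk k V n (single k p.1) := by
  have h := (basis k V).linearIndependent.comp
    (Subtype.val : {p : QuiverPath V // p.2.2.length < n} → _) Subtype.val_injective
  simp only [← basis_apply]
  refine h.map (f := (mk k V n).toLinearMap) ?_
  have hd : Disjoint {p : QuiverPath V | p.2.2.length < n} {p | n ≤ p.2.2.length} :=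
    Set.disjoint_left.2 fun p h₁ h₂ => (Nat.lt_irrefl _ (h₁.trans_le h₂))
  refine ((basis k V).linearIndependent.disjoint_span_image hd).mono (Submodule.span_mono ?_) ?_
  · rintro _ ⟨p, rfl⟩
    exact ⟨p.1, p.2, rfl⟩
  · exact fun x hx => mem_longPaths_of_mem_truncationIdeal (mk_eq_zero_iff.1 hx)

theorem span_mk_single : ⊤ ≤ Submodule.span k
    (Set.range fun p : {p : QuiverPath V // p.2.2.length < n} => mk k V n (single k p.1)) := by
  have hsurj : LinearMap.range (mk k V n).toLinearMap = ⊤ :=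
    LinearMap.range_eq_top.2 (RingCon.mkₐ_surjective (α := k) _)
  rw [← hsurj, LinearMap.range_eq_map, ← (basis k V).span_eq, Submodule.map_span,
    Submodule.span_le]
  rintro _ ⟨_, ⟨p, rfl⟩, rfl⟩
  rw [basis_apply]
  by_cases hp : p.2.2.length < n
  · exact Submodule.subset_span ⟨⟨p, hp⟩, rfl⟩
  · have h0 : mk k V n (single k p) = 0 := mk_single_eq_zero (not_lt.1 hp)
    exact h0.symm ▸ zero_mem _

/-- The truncated quiver algebra of a basic cycle has a basis which multiplies like the paths of a
cyclic quiver. -/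
theorem exists_basis_of_isBasicCycle {l : ℕ} (hQ : IsBasicCycle V l) :
    ∃ (E : ZMod l → ℕ → TruncatedQuiverAlgebra k V n)
      (b : Module.Basis (ZMod l × Fin n) k (TruncatedQuiverAlgebra k V n)),
      IsTruncatedCycleFamily l n E ∧ ∀ p, b p = E p.1 p.2 := by
  obtain ⟨e, he₂, he₁, he⟩ := hQ.exists_equiv
  have hlen : ∀ x a, (e.symm (x, a)).2.2.length = a := fun x a => by rw [← he₂]; simp
  let ι : {p : QuiverPath V // p.2.2.length < n} ≃ ZMod l × Fin n :=
    { toFun := fun p => ((e p.1).1, ⟨(e p.1).2, (he₂ p.1).trans_lt p.2⟩)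
      invFun := fun q => ⟨e.symm (q.1, q.2), (hlen _ _).trans_lt q.2.2⟩
      left_inv := fun p => by simp
      right_inv := fun q => by simp }
  refine ⟨fun x a => mk k V n (single k (e.symm (x, a))),
    (Module.Basis.mk linearIndependent_mk_single span_mk_single).reindex ι,
    ⟨fun x a h => mk_single_eq_zero (by rwa [hlen]), fun x a y c => ?_⟩, fun p => ?_⟩
  · rw [← map_mul, single_mul_single]
    have h := he (e.symm (x, a)) (e.symm (y, c))
    simp only [Equiv.apply_symm_apply] at h
    by_cases hy : y = x + a
    · obtain ⟨r, hr, hr₁, hl⟩ := exists_pathMul_eq_single (k := k) (h.2 hy)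
      rw [if_pos hy, hr, ← e.symm_apply_apply r]
      congr 3
      exact Prod.ext ((he₁ _ _ hr₁).trans (by simp)) (by rw [he₂, hl, hlen, hlen])
    · rw [if_neg hy, pathMul, dif_neg (mt h.1 hy), map_zero]
  · simp [ι]

end TruncatedQuiverAlgebra

theorem mainTheorem7 {k : Type w} [Field k] {V : Type u} [Quiver.{v} V] [Fintype V]
    (l n : ℕ) (hn : 2 ≤ n) (hQ : IsBasicCycle V l) :
    hochschildHomologyDim k (TruncatedQuiverAlgebra k V n) = ⊤ := by
  obtain ⟨E, b, hE, hb⟩ := TruncatedQuiverAlgebra.exists_basis_of_isBasicCycle (k := k) (n := n) hQ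
  exact hE.hochschildHomologyDim_eq_top hb hn hQ.1
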